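/- Let $p$ be a prime, let $k\ge 1$ be an integer, and let $G=\mathbb{Z}_{p^k}$ be the cyclic group of integers modulo $p^k$. Let $S$ be a proper subset of $G\setminus\{0\}$ that generates $G$, and put $S_0=S\cup\{0\}$. Let $\mathrm{Cay}(G,S)$ be the directed graph with vertex set $G$ and an arc from $x$ to $y$ if and only if $y-x\in S$. A set $C\subseteq G$ is a perfect code in $\mathrm{Cay}(G,S)$ if for every $v\in G$ there is exactly one $u\in C$ such that $u=v$ or there is an arc from $u$ to $v$. Write $[N]=\{0,1,\dots,N-1\}$. Let $C\subseteq G$ with $0\in C$. Then $C$ is a perfect code in $\mathrm{Cay}(G,S)$ if and only if there are integers $n\geq 1$, $0=m_0<m_1<\cdots<m_n=k$ and $1\le l_t\le m_{t+1}-m_t$ for $t\in[n]$, such that $$S_0=\left\{\sum_{t=0}^{n-1}\left(i_tp^{m_t}+\alpha_{i_0,\dots,i_t}p^{m_t+l_t}\right)\;\middle|\; i_t\in\left[p^{l_t}\right]\text{ for } t\in[n]\right\}\qquad(1)$$ for some $\alpha_{i_0,\dots,i_t}\in\mathbb{Z}_{p^k}$ with $\alpha_{0,\dots,0}=0$ (for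 each length $t+1$ of the index), and $$C=\left\{\sum_{t=0}^{n-1}\left(i_tp^{m_t+l_t}+\beta_{i_0,\dots,i_t}p^{m_{t+1}}\right)\;\middle|\; i_t\in\left[p^{m_{t+1}-m_t-l_t}\right]\text{ for } t\in[n]\right\}\qquad(2)$$ for some $\beta_{i_0,\dots,i_t}\in\mathbb{Z}_{p^k}$ with $\beta_{0,\dots,0}=0$ (for each length $t+1$ of the index). Moreover, whenever integers $m_0,\dots,m_n$ and $l_0,\dots,l_{n-1}$ as above satisfy (1) for some $\alpha$'s with $\alpha_{0,\dots,0}=0$, the set $C$ is a perfect code in $\mathrm{Cay}(G,S)$ if and only if it has the form (2), with these same $m_t,l_t$, for some $\beta$'s with $\beta_{0,\dots,0}=0$. -/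

import Mathlib

/-- The (directed) Cayley graph of an additive group `G` with connection set `S`:
there is an arc from `x` to `y` if and only if `y - x ∈ S`. -/
def cayleyDigraph {G : Type*} [AddGroup G] (S : Set G) : Digraph G where
  Adj x y := y - x ∈ S

/-- `C` is a perfect code (perfect `1`-code) in the directed graph `Γ`: every vertex `v` is at
directed distance at most `1` from exactly one `u ∈ C`, i.e. the closed out-neighbourhoods
of the vertices of `C` partition the vertex set. -/
def IsPerfectCode {V : Type*} (Γ : Digraph V) (C : Set V) : Prop :=
  ∀ v : V, ∃! u : V, u ∈ C ∧ (u = v ∨ Γ.Adj u v)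

/-- `0 = m_0 < m_1 < ⋯ < m_n = k` and `1 ≤ l_t ≤ m_{t+1} - m_t` for `t = 0, …, n-1`.
Only the values `m_0, …, m_n` and `l_0, …, l_{n-1}` matter. -/
def IsBlockData (k n : ℕ) (m l : ℕ → ℕ) : Prop :=
  m 0 = 0 ∧ m n = k ∧ (∀ t < n, m t < m (t + 1)) ∧
    ∀ t < n, 1 ≤ l t ∧ l t ≤ m (t + 1) - m t

/-- A family of coefficients indexed by the nonempty finite tuples `(i_0, …, i_t)`. -/
abbrev CoeffFamily (p k : ℕ) : Type :=
  (t : ℕ) → (Fin (t + 1) → ℕ) → ZMod (p ^ k)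

/-- The set of all `∑_{t<n} (i_t p^{m_t} + α_{i_0,…,i_t} p^{m_t+l_t})` in `ℤ / p^k`,
where `i_t` runs over `{0, …, p^{l_t} - 1}`. -/
def connectionForm (p k n : ℕ) (m l : ℕ → ℕ) (α : CoeffFamily p k) : Set (ZMod (p ^ k)) :=
  {x | ∃ i : ℕ → ℕ, (∀ t < n, i t < p ^ l t) ∧
    x = ∑ t ∈ Finset.range n, ((i t : ZMod (p ^ k)) * (p : ZMod (p ^ k)) ^ m t
          + α t (fun s => i s) * (p : ZMod (p ^ k)) ^ (m t + l t))}

/-- The set of all `∑_{t<n} (i_t p^{m_t+l_t} + β_{i_0,…,i_t} p^{m_{t+1}})` in `ℤ / p^k`,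
where `i_t` runs over `{0, …, p^{m_{t+1}-m_t-l_t} - 1}`. -/
def codeForm (p k n : ℕ) (m l : ℕ → ℕ) (β : CoeffFamily p k) : Set (ZMod (p ^ k)) :=
  {x | ∃ i : ℕ → ℕ, (∀ t < n, i t < p ^ (m (t + 1) - m t - l t)) ∧
    x = ∑ t ∈ Finset.range n, ((i t : ZMod (p ^ k)) * (p : ZMod (p ^ k)) ^ (m t + l t)
          + β t (fun s => i s) * (p : ZMod (p ^ k)) ^ m (t + 1))}

/-- `A` has the first form for some coefficients `α` with `α_{0,…,0} = 0`. -/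
def HasConnectionForm (p k n : ℕ) (m l : ℕ → ℕ) (A : Set (ZMod (p ^ k))) : Prop :=
  ∃ α : CoeffFamily p k, (∀ t < n, α t (fun _ => 0) = 0) ∧ A = connectionForm p k n m l α

/-- `C` has the second form for some coefficients `β` with `β_{0,…,0} = 0`. -/
def HasCodeForm (p k n : ℕ) (m l : ℕ → ℕ) (C : Set (ZMod (p ^ k))) : Prop :=
  ∃ β : CoeffFamily p k, (∀ t < n, β t (fun _ => 0) = 0) ∧ C = codeForm p k n m l β

/-!
A set `C` is a perfect code in `Cay(G, S)` exactly when `G = S₀ ⊕ C` is a tiling, where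
`S₀ = S ∪ {0}` (`isPerfectCode_cayleyDigraph_iff`). For `G = ℤ / p ^ k` such tilings are described
level by level in the base `p`. A set `A` is *free* at level `j` if, above each class modulo `p ^ j`
that meets `A`, all `p` classes modulo `p ^ (j + 1)` meet `A`; it is *rigid* at level `j` if only
one of them does. The central fact (`tiles_iff_exists_isDigitTree`) is that `A ⊕ C = G` if and only
if there is a set `J` of levels such that `A` is free on `J` and rigid off `J`, while `C` is rigid on
`J` and free off `J`.

For a tiling, let `ζ` be a primitive `p ^ (j + 1)`-th root of unity. The sums of `ζ ^ a` over `A` and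
of `ζ ^ c` over `C` have product `∑ v, ζ ^ v = 0`, so one of them vanishes. Its generating polynomial
is then divisible by `Φ_{p^(j+1)} = 1 + X^(p^j) + ⋯ + X^((p-1)p^j)`, which forces freeness at level
`j` (`Tiles.freeAt_or_freeAt`). Since at each level one of the two sets is free, a congruence
`v ≡ a + c` can be improved one level at a time to an equality (`exists_add_eq_of_freeAt`). Thus
freeness of one factor at level `j` forces rigidity of the other: otherwise some element would have
two representations (`Tiles.rigidAt`). The same successive approximation shows that complementary
digit trees tile.

It remains to match digit trees with the explicit parametrisations. Both of these are instances of
`digitForm`, with digit blocks `[u_t, w_t)` that vary freely, and a set through `0` has such a form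
if and only if it is a digit tree with free levels `⋃ [u_t, w_t)` (`exists_eq_digitForm_iff`). The
blocks of `S₀` and those of `C` are complementary. Every set of levels containing `0` comes from
block data, and `0` is a free level of `S₀` because `S` generates `G`. Finally, `S₀` determines its
set of free levels (`IsDigitTree.mem_iff_mem`), so that the same `m` and `l` serve for `C`.
-/

/-! ### Digit trees and tilings -/

/-- The set `A` is free at level `j` (with respect to the base `π`): every class modulo `π ^ (j + 1)`
inside a class modulo `π ^ j` that meets `A` also meets `A`. For `R = ℤ / p ^ k` and `π = p`,
the digit of weight `p ^ j` takes all values above each prefix of lower digits occurring in `A`. -/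
def FreeAt {R : Type*} [CommRing R] (π : R) (A : Set R) (j : ℕ) : Prop :=
  ∀ a ∈ A, ∀ x, π ^ j ∣ x - a → ∃ a' ∈ A, π ^ (j + 1) ∣ x - a'

/-- The set `A` is rigid at level `j`: the class of an element of `A` modulo `π ^ (j + 1)` is
determined by its class modulo `π ^ j`. -/
def RigidAt {R : Type*} [CommRing R] (π : R) (A : Set R) (j : ℕ) : Prop :=
  ∀ a ∈ A, ∀ a' ∈ A, π ^ j ∣ a - a' → π ^ (j + 1) ∣ a - a'

/-- Among the levels below `k`, the set `A` is free at those in `J` and rigid at the others. -/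
def IsDigitTree {R : Type*} [CommRing R] (π : R) (k : ℕ) (J : Set ℕ) (A : Set R) : Prop :=
  ∀ j < k, (j ∈ J → FreeAt π A j) ∧ (j ∉ J → RigidAt π A j)

/-- `A ⊕ C` is the whole group: every `v` is uniquely a sum of an element of `A` and an element
of `C`. -/
def Tiles {G : Type*} [AddCommGroup G] (A C : Set G) : Prop :=
  ∀ v : G, ∃! u : G, u ∈ C ∧ v - u ∈ A

theorem Tiles.symm {G : Type*} [AddCommGroup G] {A C : Set G} (h : Tiles A C) : Tiles C A := by
  intro v
  obtain ⟨u, ⟨hu, hvu⟩, huniq⟩ := h v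
  refine ⟨v - u, ⟨hvu, by simpa using hu⟩, ?_⟩
  rintro y ⟨hy, hvy⟩
  rw [← huniq (v - y) ⟨hvy, by simpa using hy⟩, sub_sub_cancel]

theorem Tiles.eq_of_add_eq {G : Type*} [AddCommGroup G] {A C : Set G} (h : Tiles A C)
    {a a' c c' : G} (ha : a ∈ A) (ha' : a' ∈ A) (hc : c ∈ C) (hc' : c' ∈ C)
    (heq : a + c = a' + c') : a = a' :=
  (h.symm (a + c)).unique ⟨ha, by simpa using hc⟩ ⟨ha', by simpa [heq] using hc'⟩

theorem isPerfectCode_cayleyDigraph_iff {G : Type*} [AddCommGroup G] (S C : Set G) :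
    IsPerfectCode (cayleyDigraph S) C ↔ Tiles (insert 0 S) C := by
  have key (u v : G) : (u = v ∨ (cayleyDigraph S).Adj u v) ↔ v - u ∈ insert 0 S := by
    rw [Set.mem_insert_iff, sub_eq_zero, eq_comm]
    rfl
  simp only [IsPerfectCode, Tiles, key]

/-- Successive approximation: a representation `v ≡ a + c` modulo `π ^ i` is refined to an
equality one level at a time, moving the summand whose set is free at that level. -/
theorem exists_add_eq_of_freeAt {R : Type*} [CommRing R] {π : R} {k : ℕ} (hπ : π ^ k = 0)
    {A C : Set R} {i : ℕ} (hik : i ≤ k)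
    (h : ∀ j, i ≤ j → j < k → FreeAt π A j ∨ FreeAt π C j)
    {a c v : R} (ha : a ∈ A) (hc : c ∈ C) (hv : π ^ i ∣ v - (a + c)) :
    ∃ a' ∈ A, ∃ c' ∈ C, π ^ i ∣ a' - a ∧ a' + c' = v := by
  have key : ∀ j, i ≤ j → j ≤ k →
      ∃ a' ∈ A, ∃ c' ∈ C, π ^ i ∣ a' - a ∧ π ^ j ∣ v - (a' + c') := by
    intro j hij
    induction j, hij using Nat.le_induction with
    | base => exact fun _ => ⟨a, ha, c, hc, by simp, hv⟩
    | succ j hij ih =>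
      intro hjk
      obtain ⟨a', ha', c', hc', h1, h2⟩ := ih (by omega)
      rcases h j hij hjk with hA | hC
      · obtain ⟨a'', ha'', h3⟩ := hA a' ha' (v - c') (by convert h2 using 1; ring)
        refine ⟨a'', ha'', c', hc', ?_, by convert h3 using 1; ring⟩
        have h4 := (pow_dvd_pow π hij).trans h2
        have h5 := (pow_dvd_pow π (hij.trans j.le_succ)).trans h3
        convert dvd_add h1 (dvd_sub h4 h5) using 1
        ring
      · obtain ⟨c'', hc'', h3⟩ := hC c' hc' (v - a') (by convert h2 using 1; ring)
        exact ⟨a', ha', c'', hc'', h1, by convert h3 using 1; ring⟩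
  obtain ⟨a', ha', c', hc', h1, h2⟩ := key k hik le_rfl
  rw [hπ, zero_dvd_iff, sub_eq_zero] at h2
  exact ⟨a', ha', c', hc', h1, h2.symm⟩

theorem IsDigitTree.tiles {R : Type*} [CommRing R] {π : R} {k : ℕ} (hπ : π ^ k = 0)
    {J : Set ℕ} {A C : Set R} (hA : IsDigitTree π k J A) (hC : IsDigitTree π k Jᶜ C)
    (hA0 : A.Nonempty) (hC0 : C.Nonempty) : Tiles A C := by
  obtain ⟨a₀, ha₀⟩ := hA0
  obtain ⟨c₀, hc₀⟩ := hC0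
  intro v
  obtain ⟨a, ha, c, hc, -, hac⟩ := exists_add_eq_of_freeAt (v := v) hπ k.zero_le
    (fun j _ hj => (em (j ∈ J)).imp (hA j hj).1 (hC j hj).1) ha₀ hc₀ (by simp)
  refine ⟨c, ⟨hc, by rwa [← hac, add_sub_cancel_right]⟩, ?_⟩
  rintro y ⟨hy, hvy⟩
  have key : ∀ j ≤ k, π ^ j ∣ y - c := by
    intro j
    induction j with
    | zero => simp
    | succ j ih =>
      intro hj
      specialize ih (by omega)
      by_cases hJ : j ∈ J
      · exact (hC j hj).2 (by simpa using hJ) y hy c hc ih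
      · have h1 := (hA j hj).2 hJ a ha (v - y) hvy
        have h2 : a - (v - y) = y - c := by rw [← hac]; ring
        rw [h2] at h1
        exact h1 ih
  have h0 := key k le_rfl
  rwa [hπ, zero_dvd_iff, sub_eq_zero] at h0

/-- If `A` were not rigid at a level where `C` is free, successive approximation would turn two
elements of `A` that first differ at this level into two representations of one element. -/
theorem Tiles.rigidAt {R : Type*} [CommRing R] {π : R} {k : ℕ} (hπ : π ^ k = 0)
    {A C : Set R} (h : Tiles A C) (hfree : ∀ j < k, FreeAt π A j ∨ FreeAt π C j)
    (hC : C.Nonempty) {j : ℕ} (hj : j < k) (hCj : FreeAt π C j) : RigidAt π A j := by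
  intro a ha a' ha' hdvd
  obtain ⟨c, hc⟩ := hC
  obtain ⟨c', hc', h1⟩ := hCj c hc (a + c - a') (by convert hdvd using 1; ring)
  obtain ⟨a'', ha'', c'', hc'', h2, h3⟩ := exists_add_eq_of_freeAt (v := a + c) hπ
    (show j + 1 ≤ k from hj) (fun i _ hi => hfree i hi) ha' hc' (by convert h1 using 1; ring)
  rwa [h.eq_of_add_eq ha ha'' hc hc'' h3.symm]

theorem Tiles.exists_isDigitTree {R : Type*} [CommRing R] {π : R} {k : ℕ} (hπ : π ^ k = 0)
    {A C : Set R} (h : Tiles A C) (hfree : ∀ j < k, FreeAt π A j ∨ FreeAt π C j)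
    (hA : A.Nonempty) (hC : C.Nonempty) :
    ∃ J : Set ℕ, IsDigitTree π k J A ∧ IsDigitTree π k Jᶜ C := by
  refine ⟨{j | FreeAt π A j}, fun j hj => ⟨id, fun hJ => ?_⟩,
    fun j hj => ⟨fun hJ => ?_, fun hJ => ?_⟩⟩
  · exact h.rigidAt hπ hfree hC hj ((hfree j hj).resolve_left hJ)
  · exact (hfree j hj).resolve_left hJ
  · exact h.symm.rigidAt hπ (fun i hi => (hfree i hi).symm) hA hj (not_not.1 hJ)

theorem FreeAt.not_rigidAt {R : Type*} [CommRing R] {π : R} {A : Set R} {j : ℕ}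
    (hA : A.Nonempty) (hπ : ¬ π ^ (j + 1) ∣ π ^ j) (hfree : FreeAt π A j) : ¬ RigidAt π A j := by
  intro hr
  obtain ⟨a, ha⟩ := hA
  obtain ⟨a', ha', h1⟩ := hfree a ha (a + π ^ j) (by simp)
  have h2 : π ^ j ∣ a - a' := by
    have := dvd_sub ((pow_dvd_pow π j.le_succ).trans h1) (dvd_refl (π ^ j))
    convert this using 1
    ring
  have := dvd_sub h1 (hr a ha a' ha' h2)
  exact hπ (by convert this using 1; ring)

/-- The set of free levels of a digit tree is unique. -/
theorem IsDigitTree.mem_iff_mem {R : Type*} [CommRing R] {π : R} {k : ℕ} {J J' : Set ℕ} {A : Set R}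
    (hA : A.Nonempty) (hπ : ∀ j < k, ¬ π ^ (j + 1) ∣ π ^ j)
    (h : IsDigitTree π k J A) (h' : IsDigitTree π k J' A) {j : ℕ} (hj : j < k) :
    j ∈ J ↔ j ∈ J' := by
  constructor
  · intro hJ
    by_contra hJ'
    exact ((h j hj).1 hJ).not_rigidAt hA (hπ j hj) ((h' j hj).2 hJ')
  · intro hJ'
    by_contra hJ
    exact ((h' j hj).1 hJ').not_rigidAt hA (hπ j hj) ((h j hj).2 hJ)

theorem IsDigitTree.congr {R : Type*} [CommRing R] {π : R} {k : ℕ} {J J' : Set ℕ} {A : Set R}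
    (h : IsDigitTree π k J A) (hJ : ∀ j < k, (j ∈ J ↔ j ∈ J')) : IsDigitTree π k J' A :=
  fun j hj => by simpa only [hJ j hj] using h j hj

/-- Freeness at consecutive levels allows all these digits to be prescribed at once. -/
theorem exists_mem_of_freeAt {R : Type*} [CommRing R] {π : R} {A : Set R} {i j : ℕ} (hij : i ≤ j)
    (h : ∀ r, i ≤ r → r < j → FreeAt π A r) {a x : R} (ha : a ∈ A) (hx : π ^ i ∣ x - a) :
    ∃ a' ∈ A, π ^ j ∣ x - a' := by
  induction j, hij using Nat.le_induction with
  | base => exact ⟨a, ha, hx⟩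
  | succ j hij ih =>
    obtain ⟨a', ha', h1⟩ := ih fun r h1 h2 => h r h1 (by omega)
    exact h j hij (by omega) a' ha' x h1

theorem dvd_sub_of_rigidAt {R : Type*} [CommRing R] {π : R} {A : Set R} {i j : ℕ} (hij : i ≤ j)
    (h : ∀ r, i ≤ r → r < j → RigidAt π A r) {a a' : R} (ha : a ∈ A) (ha' : a' ∈ A)
    (hx : π ^ i ∣ a - a') : π ^ j ∣ a - a' := by
  induction j, hij using Nat.le_induction with
  | base => exact hx
  | succ j hij ih =>
    exact h j hij (by omega) a ha a' ha' (ih fun r h1 h2 => h r h1 (by omega))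

/-! ### Vanishing character sums -/

theorem ZMod.natCast_pow_dvd_intCast_iff {p k j : ℕ} (hj : j ≤ k) (z : ℤ) :
    (p : ZMod (p ^ k)) ^ j ∣ (z : ZMod (p ^ k)) ↔ (p : ℤ) ^ j ∣ z := by
  constructor
  · rintro ⟨y, hy⟩
    obtain ⟨y, rfl⟩ := ZMod.intCast_surjective y
    have h1 : ((p ^ k : ℕ) : ℤ) ∣ p ^ j * y - z := by
      rw [← ZMod.intCast_eq_intCast_iff_dvd_sub, hy]
      push_cast
      rfl
    rw [Nat.cast_pow] at h1
    have h2 := dvd_sub (dvd_mul_right ((p : ℤ) ^ j) y) ((pow_dvd_pow (p : ℤ) hj).trans h1)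
    simpa using h2
  · rintro ⟨y, rfl⟩
    exact ⟨y, by push_cast; rfl⟩

theorem ZMod.natCast_pow_eq_zero (p k : ℕ) : (p : ZMod (p ^ k)) ^ k = 0 := by
  rw [← Nat.cast_pow, ZMod.natCast_self]

theorem ZMod.not_natCast_pow_succ_dvd_pow {p k j : ℕ} (hp : p.Prime) (hj : j < k) :
    ¬ (p : ZMod (p ^ k)) ^ (j + 1) ∣ (p : ZMod (p ^ k)) ^ j := by
  have := ZMod.natCast_pow_dvd_intCast_iff (p := p) (show j + 1 ≤ k from hj) ((p : ℤ) ^ j)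
  push_cast at this
  rw [this, pow_dvd_pow_iff (by exact_mod_cast hp.ne_zero) (Nat.prime_iff_prime_int.1 hp).not_isUnit]
  omega

/-- A multiple of `Φ_{p^(j+1)} = 1 + X^(p^j) + ⋯ + X^((p-1)p^j)` of degree below `p ^ (j + 1)` is
that cyclotomic polynomial times a polynomial of degree below `p ^ j`, so its coefficients are
periodic with period `p ^ j`. -/
theorem Polynomial.coeff_eq_of_cyclotomic_dvd {p j : ℕ} (hp : p.Prime) {f : Polynomial ℤ}
    (hf : f.natDegree < p ^ (j + 1)) (hdvd : Polynomial.cyclotomic (p ^ (j + 1)) ℤ ∣ f)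
    {r s : ℕ} (hr : r < p ^ (j + 1)) (hs : s < p ^ (j + 1)) (hrs : r ≡ s [MOD p ^ j]) :
    f.coeff r = f.coeff s := by
  obtain ⟨Q, rfl⟩ := hdvd
  rcases eq_or_ne Q 0 with rfl | hQ
  · simp
  have hpj : 0 < p ^ j := pow_pos hp.pos j
  have hdeg : Q.natDegree < p ^ j := by
    rw [(Polynomial.cyclotomic.monic _ ℤ).natDegree_mul' hQ, Polynomial.natDegree_cyclotomic,
      Nat.totient_prime_pow_succ hp] at hf
    have : p ^ (j + 1) = p ^ j * (p - 1) + p ^ j := by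
      rw [pow_succ, ← Nat.mul_succ, Nat.succ_eq_add_one, Nat.sub_add_cancel hp.one_le]
    omega
  have key : ∀ n < p ^ (j + 1),
      (Polynomial.cyclotomic (p ^ (j + 1)) ℤ * Q).coeff n = Q.coeff (n % p ^ j) := by
    intro n hn
    have hlt : n / p ^ j < p := Nat.div_lt_of_lt_mul (by rwa [← pow_succ])
    rw [Polynomial.cyclotomic_prime_pow_eq_geom_sum hp, Finset.sum_mul, Polynomial.finsetSum_coeff,
      Finset.sum_eq_single_of_mem (n / p ^ j) (Finset.mem_range.2 hlt)]
    · rw [← pow_mul, Polynomial.coeff_X_pow_mul', if_pos (Nat.mul_div_le n _), Nat.mod_def]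
    · intro i _ hi
      rw [← pow_mul, Polynomial.coeff_X_pow_mul']
      split_ifs with hle
      · apply Polynomial.coeff_eq_zero_of_natDegree_lt
        have h1 : i < n / p ^ j :=
          lt_of_le_of_ne ((Nat.le_div_iff_mul_le hpj).2 (by rwa [mul_comm])) hi
        have h2 : p ^ j * (i + 1) ≤ n := (Nat.mul_le_mul_left _ h1).trans (Nat.mul_div_le n _)
        rw [mul_add] at h2
        omega
      · rfl
  rw [key r hr, key s hs, hrs]

open Classical in
/-- The vanishing of a character sum over `A` at a primitive `p ^ (j + 1)`-th root of unity forces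
the number of elements of `A` in a class modulo `p ^ (j + 1)` to depend only on the class modulo
`p ^ j`. -/
theorem freeAt_of_sum_eq_zero {p k j : ℕ} [NeZero (p ^ k)] (hp : p.Prime) (hj : j < k)
    {A : Set (ZMod (p ^ k))} {ζ : ℂ} (hζ : IsPrimitiveRoot ζ (p ^ (j + 1)))
    (hsum : ∑ a ∈ A.toFinset, ζ ^ a.val = 0) : FreeAt (p : ZMod (p ^ k)) A j := by
  have hpos : 0 < p ^ (j + 1) := pow_pos hp.pos _
  -- the generating polynomial of the residues of `A` modulo `p ^ (j + 1)`
  set f : Polynomial ℤ := ∑ a ∈ A.toFinset, Polynomial.X ^ (a.val % p ^ (j + 1)) with hf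
  have hdeg : f.natDegree < p ^ (j + 1) := by
    refine lt_of_le_of_lt (Polynomial.natDegree_sum_le_of_forall_le (n := p ^ (j + 1) - 1) _ _ ?_)
      (by omega)
    intro a _
    rw [Polynomial.natDegree_X_pow]
    have := Nat.mod_lt a.val hpos
    omega
  have hdvd : Polynomial.cyclotomic (p ^ (j + 1)) ℤ ∣ f := by
    rw [Polynomial.cyclotomic_eq_minpoly hζ hpos]
    apply minpoly.isIntegrallyClosed_dvd (hζ.isIntegral hpos)
    rw [hf, map_sum, ← hsum]
    refine Finset.sum_congr rfl fun a _ => ?_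
    rw [map_pow, Polynomial.aeval_X, ← pow_eq_pow_mod _ hζ.pow_eq_one]
  have hcoeff (r : ℕ) : f.coeff r = (A.toFinset.filter fun a => r = a.val % p ^ (j + 1)).card := by
    rw [hf, Polynomial.finsetSum_coeff]
    simp only [Polynomial.coeff_X_pow]
    rw [Finset.sum_boole]
  have hval (y : ZMod (p ^ k)) : (y.val : ZMod (p ^ k)) = y := ZMod.natCast_zmod_val y
  have hmod (x y : ZMod (p ^ k)) {i : ℕ} (hi : i ≤ k) :
      (p : ZMod (p ^ k)) ^ i ∣ x - y ↔ y.val ≡ x.val [MOD p ^ i] := by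
    have := ZMod.natCast_pow_dvd_intCast_iff (p := p) hi ((x.val : ℤ) - y.val)
    push_cast at this
    rw [hval, hval] at this
    rw [this, Nat.modEq_iff_dvd]
    push_cast
    rfl
  intro a ha x hx
  rw [hmod x a hj.le] at hx
  have heq := Polynomial.coeff_eq_of_cyclotomic_dvd hp hdeg hdvd
    (Nat.mod_lt a.val hpos) (Nat.mod_lt x.val hpos)
    (by
      have hd : p ^ j ∣ p ^ (j + 1) := pow_dvd_pow p j.le_succ
      exact ((Nat.mod_modEq _ _).of_dvd hd).trans (hx.trans ((Nat.mod_modEq _ _).of_dvd hd).symm))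
  rw [hcoeff, hcoeff, Nat.cast_inj] at heq
  have hne : 0 < (A.toFinset.filter fun b => a.val % p ^ (j + 1) = b.val % p ^ (j + 1)).card :=
    Finset.card_pos.2 ⟨a, by simpa using ha⟩
  rw [heq, Finset.card_pos] at hne
  obtain ⟨a', ha'⟩ := hne
  rw [Finset.mem_filter, Set.mem_toFinset] at ha'
  exact ⟨a', ha'.1, (hmod x a' hj).2 ha'.2.symm⟩

open Classical in
/-- The character sums of the two factors multiply to the character sum of the whole group, which
is zero; so at each level one of them vanishes. -/
theorem Tiles.freeAt_or_freeAt {p k : ℕ} (hp : p.Prime) {A C : Set (ZMod (p ^ k))}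
    (h : Tiles A C) {j : ℕ} (hj : j < k) :
    FreeAt (p : ZMod (p ^ k)) A j ∨ FreeAt (p : ZMod (p ^ k)) C j := by
  have : NeZero (p ^ k) := ⟨pow_ne_zero _ hp.ne_zero⟩
  have hζ := Complex.isPrimitiveRoot_exp (p ^ (j + 1)) (pow_ne_zero _ hp.ne_zero)
  generalize Complex.exp (2 * Real.pi * Complex.I / (p ^ (j + 1) : ℕ)) = ζ at hζ
  have hζ1 : ζ ^ (p ^ k) = 1 := (hζ.pow_eq_one_iff_dvd _).2 (pow_dvd_pow p hj)
  set ψ : AddChar (ZMod (p ^ k)) ℂ := AddChar.zmodChar (p ^ k) hζ1 with hψ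
  have hψa (a : ZMod (p ^ k)) : ψ a = ζ ^ a.val := AddChar.zmodChar_apply hζ1 a
  have hψ1 : ψ ≠ 1 := by
    intro h1
    have h2 : ψ ((1 : ℕ) : ZMod (p ^ k)) = ζ ^ 1 := AddChar.zmodChar_apply' hζ1 1
    rw [h1, AddChar.one_apply, pow_one] at h2
    exact hζ.ne_one (Nat.one_lt_pow j.succ_ne_zero hp.one_lt) h2.symm
  have hsum : (∑ a ∈ A.toFinset, ζ ^ a.val) * ∑ c ∈ C.toFinset, ζ ^ c.val = 0 := by
    rw [← AddChar.sum_eq_zero_of_ne_one hψ1, Finset.sum_mul_sum, ← Finset.sum_product']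
    refine Finset.sum_bij (fun x _ => x.1 + x.2) (fun _ _ => Finset.mem_univ _) ?_ ?_ ?_
    · rintro ⟨a, c⟩ hac ⟨a', c'⟩ hac' heq
      simp only [Finset.mem_product, Set.mem_toFinset] at hac hac' heq
      have h1 := h.eq_of_add_eq hac.1 hac'.1 hac.2 hac'.2 heq
      subst h1
      simpa using heq
    · intro v _
      obtain ⟨u, ⟨hu, hvu⟩, -⟩ := h v
      exact ⟨(v - u, u), by simp [hu, hvu], by simp⟩
    · rintro ⟨a, c⟩ _
      rw [AddChar.map_add_eq_mul, hψa, hψa]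
  rcases mul_eq_zero.1 hsum with h0 | h0
  · exact Or.inl (freeAt_of_sum_eq_zero hp hj hζ h0)
  · exact Or.inr (freeAt_of_sum_eq_zero hp hj hζ h0)

/-! ### Parametrised sets of digit expansions -/

/-- The levels `u_t ≤ j < w_t`, `t < n`, of the digits that vary freely. -/
def freeLevels (n : ℕ) (u w : ℕ → ℕ) : Set ℕ := {j | ∃ t < n, u t ≤ j ∧ j < w t}

/-- The set of all `∑_{t<n} (i_t p^{u_t} + γ_{i_0,…,i_t} p^{w_t})` in `ℤ / p^k`, where `i_t` runs
over `{0, …, p^{w_t-u_t} - 1}`. Both `connectionForm` and `codeForm` are of this kind. -/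
def digitForm (p k n : ℕ) (u w : ℕ → ℕ) (γ : CoeffFamily p k) : Set (ZMod (p ^ k)) :=
  {x | ∃ i : ℕ → ℕ, (∀ t < n, i t < p ^ (w t - u t)) ∧
    x = ∑ t ∈ Finset.range n, ((i t : ZMod (p ^ k)) * (p : ZMod (p ^ k)) ^ u t
          + γ t (fun s => i s) * (p : ZMod (p ^ k)) ^ w t)}

theorem zero_mem_digitForm {p k n : ℕ} (hp : p.Prime) {u w : ℕ → ℕ} {γ : CoeffFamily p k}
    (hγ : ∀ t < n, γ t (fun _ => 0) = 0) : 0 ∈ digitForm p k n u w γ := by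
  refine ⟨fun _ => 0, fun t _ => pow_pos hp.pos _, (Finset.sum_eq_zero fun t ht => ?_).symm⟩
  rw [hγ t (Finset.mem_range.1 ht)]
  simp

theorem coeff_congr {p k : ℕ} (γ : CoeffFamily p k) {t : ℕ} {i i' : ℕ → ℕ}
    (h : ∀ s ≤ t, i s = i' s) :
    γ t (fun s => i s) = γ t (fun s => i' s) :=
  congrArg (γ t) (funext fun s => h s (Nat.lt_succ_iff.1 s.2))

theorem ZMod.eq_of_natCast_pow_dvd_sub {p k : ℕ} {u w c c' : ℕ} (hp : p.Prime)
    (huw : u ≤ w) (hwk : w ≤ k) (hc : c < p ^ (w - u)) (hc' : c' < p ^ (w - u))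
    (h : (p : ZMod (p ^ k)) ^ w ∣ ((c : ZMod (p ^ k)) - c') * (p : ZMod (p ^ k)) ^ u) : c = c' := by
  have := ZMod.natCast_pow_dvd_intCast_iff (p := p) hwk (((c : ℤ) - c') * (p : ℤ) ^ u)
  push_cast at this
  rw [this] at h
  have h1 : (p : ℤ) ^ w = p ^ (w - u) * p ^ u := by rw [← pow_add, Nat.sub_add_cancel huw]
  rw [h1] at h
  have h2 := Int.dvd_of_mul_dvd_mul_right (pow_ne_zero u (by exact_mod_cast hp.ne_zero)) h
  have h3 : c' ≡ c [MOD p ^ (w - u)] := by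
    rw [Nat.modEq_iff_dvd]
    exact_mod_cast h2
  exact (h3.eq_of_lt_of_lt hc' hc).symm

/-- Any residue divisible by `p ^ u` is `c p ^ u` modulo `p ^ w` for some digit block `c`. -/
theorem ZMod.exists_lt_natCast_pow_dvd_sub {p k : ℕ} {u w : ℕ} (hp : p.Prime)
    (huw : u ≤ w) {x : ZMod (p ^ k)} (hx : (p : ZMod (p ^ k)) ^ u ∣ x) :
    ∃ c < p ^ (w - u), (p : ZMod (p ^ k)) ^ w ∣ x - c * (p : ZMod (p ^ k)) ^ u := by
  have : NeZero (p ^ k) := ⟨pow_ne_zero _ hp.ne_zero⟩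
  obtain ⟨y, rfl⟩ := hx
  refine ⟨y.val % p ^ (w - u), Nat.mod_lt _ (pow_pos hp.pos _), ((y.val / p ^ (w - u) : ℕ) :
    ZMod (p ^ k)), ?_⟩
  have h1 : (y.val : ZMod (p ^ k)) = y := ZMod.natCast_zmod_val y
  have h2 : (p : ZMod (p ^ k)) ^ w = p ^ (w - u) * p ^ u := by
    rw [← pow_add, Nat.sub_add_cancel huw]
  nth_rewrite 1 [← h1, ← Nat.mod_add_div y.val (p ^ (w - u))]
  rw [h2]
  push_cast
  ring

theorem isDigitTree_digitForm {p k n : ℕ} (hp : p.Prime) {u w : ℕ → ℕ}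
    (huw : ∀ t < n, u t ≤ w t) (hwu : ∀ s t, s < t → t < n → w s ≤ u t) (hwk : ∀ t < n, w t ≤ k)
    (γ : CoeffFamily p k) :
    IsDigitTree (p : ZMod (p ^ k)) k (freeLevels n u w) (digitForm p k n u w γ) := by
  set π : ZMod (p ^ k) := (p : ZMod (p ^ k)) with hπ
  intro j hj
  constructor
  · rintro ⟨t, ht, hut, hjw⟩ _ ⟨i, hi, rfl⟩ x hx
    -- keep the digit blocks before `t`, and choose the block `t` afresh
    set P : ZMod (p ^ k) := ∑ s ∈ Finset.range t, ((i s : ZMod (p ^ k)) * π ^ u s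
      + γ s (fun r => i r) * π ^ w s) with hP
    have hxP : π ^ u t ∣ x - P := by
      rw [← Finset.sum_range_add_sum_Ico _ ht.le, ← hP] at hx
      have h1 := (pow_dvd_pow π hut).trans hx
      have h2 : π ^ u t ∣ ∑ s ∈ Finset.Ico t n, ((i s : ZMod (p ^ k)) * π ^ u s
          + γ s (fun r => i r) * π ^ w s) := by
        refine Finset.dvd_sum fun s hs => ?_
        rw [Finset.mem_Ico] at hs
        have h3 : u t ≤ u s := by
          rcases hs.1.eq_or_lt with rfl | h
          · rfl
          · exact (huw t ht).trans (hwu t s h hs.2)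
        exact dvd_add (Dvd.dvd.mul_left (pow_dvd_pow π h3) _)
          (Dvd.dvd.mul_left (pow_dvd_pow π (h3.trans (huw s hs.2))) _)
      convert dvd_add h1 h2 using 1
      ring
    obtain ⟨c, hc, hcx⟩ := ZMod.exists_lt_natCast_pow_dvd_sub hp (huw t ht) hxP
    set i' : ℕ → ℕ := fun s => if s < t then i s else if s = t then c else 0 with hi'
    have hi't : i' t = c := by simp [hi']
    have hi'lt (s : ℕ) (hs : s < t) : i' s = i s := by simp [hi', hs]
    refine ⟨_, ⟨i', fun s hs => ?_, rfl⟩, ?_⟩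
    · rcases lt_trichotomy s t with h | rfl | h
      · rw [hi'lt s h]
        exact hi s hs
      · rwa [hi't]
      · simp only [hi', not_lt.2 h.le, h.ne', if_false]
        exact pow_pos hp.pos _
    · rw [← Finset.sum_range_add_sum_Ico _ ht.le]
      have h1 : ∑ s ∈ Finset.range t, ((i' s : ZMod (p ^ k)) * π ^ u s
          + γ s (fun r => i' r) * π ^ w s) = P := by
        refine Finset.sum_congr rfl fun s hs => ?_
        rw [Finset.mem_range] at hs
        rw [hi'lt s hs, coeff_congr γ fun r hr => hi'lt r (hr.trans_lt hs)]
      rw [h1, Finset.sum_eq_sum_Ico_succ_bot ht, hi't]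
      have h2 : π ^ (j + 1) ∣ ∑ s ∈ Finset.Ico (t + 1) n, ((i' s : ZMod (p ^ k)) * π ^ u s
          + γ s (fun r => i' r) * π ^ w s) := by
        refine Finset.dvd_sum fun s hs => ?_
        rw [Finset.mem_Ico] at hs
        have h3 : j + 1 ≤ u s := (Nat.succ_le_of_lt hjw).trans (hwu t s hs.1 hs.2)
        exact dvd_add (Dvd.dvd.mul_left (pow_dvd_pow π h3) _)
          (Dvd.dvd.mul_left (pow_dvd_pow π (h3.trans (huw s hs.2))) _)
      have h3 := (pow_dvd_pow π (Nat.succ_le_of_lt hjw)).trans hcx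
      have h4 : π ^ (j + 1) ∣ γ t (fun r => i' r) * π ^ w t :=
        Dvd.dvd.mul_left (pow_dvd_pow π (Nat.succ_le_of_lt hjw)) _
      convert dvd_sub (dvd_sub h3 h4) h2 using 1
      ring
  · rintro hJ _ ⟨i, hi, rfl⟩ _ ⟨i', hi', rfl⟩ hdvd
    rw [← Finset.sum_sub_distrib] at hdvd ⊢
    set D : ℕ → ZMod (p ^ k) := fun t => ((i t : ZMod (p ^ k)) * π ^ u t
      + γ t (fun r => i r) * π ^ w t) - ((i' t : ZMod (p ^ k)) * π ^ u t
      + γ t (fun r => i' r) * π ^ w t) with hD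
    change π ^ j ∣ ∑ t ∈ Finset.range n, D t at hdvd
    change π ^ (j + 1) ∣ ∑ t ∈ Finset.range n, D t
    have hDdvd (t : ℕ) (ht : t < n) : π ^ u t ∣ D t :=
      dvd_sub (dvd_add (dvd_mul_left _ _) (Dvd.dvd.mul_left (pow_dvd_pow π (huw t ht)) _))
        (dvd_add (dvd_mul_left _ _) (Dvd.dvd.mul_left (pow_dvd_pow π (huw t ht)) _))
    have hD0 (t : ℕ) (h : ∀ s ≤ t, i s = i' s) : D t = 0 := by
      simp only [hD]
      rw [coeff_congr γ h, h t le_rfl, sub_self]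
    -- the blocks that end by level `j` are determined by the residue modulo `p ^ j`
    have heq : ∀ t < n, w t ≤ j → i t = i' t := by
      intro t
      induction t using Nat.strong_induction_on with
      | _ t ih =>
        intro ht hwt
        have hprev (s : ℕ) (hs : s < t) : i s = i' s :=
          ih s hs (hs.trans ht) ((hwu s t hs ht).trans ((huw t ht).trans hwt))
        have h1 : ∑ s ∈ Finset.range t, D s = 0 := Finset.sum_eq_zero fun s hs =>
          hD0 s fun r hr => hprev r (hr.trans_lt (Finset.mem_range.1 hs))
        have h2 : π ^ w t ∣ ∑ s ∈ Finset.Ico (t + 1) n, D s := by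
          refine Finset.dvd_sum fun s hs => ?_
          rw [Finset.mem_Ico] at hs
          exact (pow_dvd_pow π (hwu t s hs.1 hs.2)).trans (hDdvd s hs.2)
        have h3 := (pow_dvd_pow π hwt).trans hdvd
        rw [← Finset.sum_range_add_sum_Ico _ ht.le, h1, zero_add,
          Finset.sum_eq_sum_Ico_succ_bot ht] at h3
        have h4 := (dvd_add_left h2).1 h3
        refine ZMod.eq_of_natCast_pow_dvd_sub hp (huw t ht) (hwk t ht) (hi t ht) (hi' t ht) ?_
        have h5 := dvd_sub h4 (dvd_mul_left (π ^ w t)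
          (γ t (fun r => i r) - γ t (fun r => i' r)))
        convert h5 using 1
        simp only [hD]
        ring
    refine Finset.dvd_sum fun t ht => ?_
    rw [Finset.mem_range] at ht
    by_cases hwt : w t ≤ j
    · rw [hD0 t fun s hs => heq s (hs.trans_lt ht) ?_]
      · exact dvd_zero _
      · rcases hs.eq_or_lt with rfl | h
        · exact hwt
        · exact (hwu s t h ht).trans ((huw t ht).trans hwt)
    · have : j + 1 ≤ u t := by
        by_contra h
        exact hJ ⟨t, ht, by omega, by omega⟩
      exact (pow_dvd_pow π this).trans (hDdvd t ht)

/-- The partial sums `∑_{s<t} (i_s p^{u_s} + γ_{i_0,…,i_s} p^{w_s})` when the correction `γ` at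
stage `t` is a function `g` of the stage, the preceding partial sum and the digit block `i_t`. -/
def partialSum {p k : ℕ} (u w : ℕ → ℕ) (g : ℕ → ZMod (p ^ k) → ℕ → ZMod (p ^ k)) (i : ℕ → ℕ) :
    ℕ → ZMod (p ^ k)
  | 0 => 0
  | t + 1 => partialSum u w g i t + i t * (p : ZMod (p ^ k)) ^ u t
      + g t (partialSum u w g i t) (i t) * (p : ZMod (p ^ k)) ^ w t

theorem partialSum_congr {p k : ℕ} (u w : ℕ → ℕ) (g : ℕ → ZMod (p ^ k) → ℕ → ZMod (p ^ k))
    {i i' : ℕ → ℕ} {t : ℕ} (h : ∀ s < t, i s = i' s) :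
    partialSum u w g i t = partialSum u w g i' t := by
  induction t with
  | zero => rfl
  | succ t ih =>
    rw [partialSum, partialSum, ih fun s hs => h s (by omega), h t (by omega)]

/-- The coefficient family whose partial sums are those of `partialSum`; a finite index tuple is
extended by zeros. -/
def coeffOfStep {p k : ℕ} (u w : ℕ → ℕ) (g : ℕ → ZMod (p ^ k) → ℕ → ZMod (p ^ k)) :
    CoeffFamily p k :=
  fun t v => g t (partialSum u w g (fun s => if h : s < t + 1 then v ⟨s, h⟩ else 0) t)
    (v (Fin.last t))

theorem sum_coeffOfStep {p k : ℕ} (u w : ℕ → ℕ) (g : ℕ → ZMod (p ^ k) → ℕ → ZMod (p ^ k))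
    (i : ℕ → ℕ) (n : ℕ) :
    ∑ t ∈ Finset.range n, ((i t : ZMod (p ^ k)) * (p : ZMod (p ^ k)) ^ u t
      + coeffOfStep u w g t (fun s => i s) * (p : ZMod (p ^ k)) ^ w t) =
      partialSum u w g i n := by
  induction n with
  | zero => rfl
  | succ n ih =>
    have h : partialSum u w g (fun s => if _ : s < n + 1 then i s else 0) n =
        partialSum u w g i n :=
      partialSum_congr u w g fun s hs => by simp [Nat.lt_succ_of_lt hs]
    rw [Finset.sum_range_succ, ih, partialSum, add_assoc]
    simp only [coeffOfStep, h, Fin.val_last]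

/-- Conversely, a digit tree through `0` is parametrised by its free digits: the corrections are
chosen so that every partial sum already lies in `A`. -/
theorem exists_eq_digitForm {p k n : ℕ} (hp : p.Prime) {u w : ℕ → ℕ}
    (huw : ∀ t < n, u t ≤ w t) (hwu : ∀ s t, s < t → t < n → w s ≤ u t) (hwk : ∀ t < n, w t ≤ k)
    {A : Set (ZMod (p ^ k))} (h0 : 0 ∈ A)
    (hA : IsDigitTree (p : ZMod (p ^ k)) k (freeLevels n u w) A) :
    ∃ γ : CoeffFamily p k, (∀ t < n, γ t (fun _ => 0) = 0) ∧ A = digitForm p k n u w γ := by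
  set π : ZMod (p ^ k) := (p : ZMod (p ^ k)) with hπ
  have hstep (t : ℕ) (x : ZMod (p ^ k)) (c : ℕ) : ∃ y : ZMod (p ^ k),
      (t < n → x ∈ A → x + c * π ^ u t + y * π ^ w t ∈ A) ∧ (c = 0 → y = 0) := by
    by_cases hx : t < n ∧ x ∈ A
    · obtain ⟨ht, hx⟩ := hx
      rcases eq_or_ne c 0 with rfl | hc
      · exact ⟨0, fun _ _ => by simpa using hx, fun _ => rfl⟩
      · obtain ⟨a, ha, y, hy⟩ := exists_mem_of_freeAt (π := π) (huw t ht)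
          (fun r h1 h2 => (hA r (h2.trans_le (hwk t ht))).1 ⟨t, ht, h1, h2⟩) hx
          (x := x + c * π ^ u t) (by simp)
        refine ⟨-y, fun _ _ => ?_, fun h => absurd h hc⟩
        convert ha using 1
        linear_combination hy
    · exact ⟨0, fun h1 h2 => absurd ⟨h1, h2⟩ hx, fun _ => rfl⟩
  choose g hg hg0 using hstep
  refine ⟨coeffOfStep u w g, fun t _ => hg0 _ _ _ rfl, ?_⟩
  have hmem (i : ℕ → ℕ) : ∀ t ≤ n, partialSum u w g i t ∈ A := by
    intro t
    induction t with
    | zero => exact fun _ => h0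
    | succ t ih => exact fun ht => hg t _ (i t) ht (ih (by omega))
  ext a
  constructor
  · intro ha
    -- the digit blocks of `a` are read off from the lowest one upwards
    have key : ∀ t ≤ n, ∃ i : ℕ → ℕ, (∀ s < t, i s < p ^ (w s - u s)) ∧
        ∀ j ≤ k, (∀ s, t ≤ s → s < n → j ≤ u s) → π ^ j ∣ a - partialSum u w g i t := by
      intro t
      induction t with
      | zero =>
        refine fun _ => ⟨fun _ => 0, by simp, fun j hj hu => ?_⟩
        refine dvd_sub_of_rigidAt j.zero_le (fun r _ hr => (hA r (hr.trans_le hj)).2 ?_) ha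
          (hmem _ 0 n.zero_le) (by simp)
        rintro ⟨s, hs, h1, -⟩
        have := hu s s.zero_le hs
        omega
      | succ t ih =>
        intro ht
        obtain ⟨i, hi, hia⟩ := ih (by omega)
        have h1 := hia (u t) ((huw t ht).trans (hwk t ht)) fun s hts hs => by
          rcases hts.eq_or_lt with rfl | h
          · rfl
          · exact (huw t ht).trans (hwu t s h hs)
        obtain ⟨c, hc, hca⟩ := ZMod.exists_lt_natCast_pow_dvd_sub hp (huw t ht) h1
        have hP : partialSum u w g (Function.update i t c) t = partialSum u w g i t :=
          partialSum_congr u w g fun s hs => Function.update_of_ne hs.ne _ _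
        refine ⟨Function.update i t c, fun s hs => ?_, fun j hj hu => ?_⟩
        · rcases (Nat.lt_succ_iff.1 hs).eq_or_lt with rfl | h
          · simpa using hc
          · rw [Function.update_of_ne h.ne]
            exact hi s h
        · have h2 : π ^ w t ∣ a - partialSum u w g (Function.update i t c) (t + 1) := by
            rw [partialSum, hP, Function.update_self]
            have h3 := dvd_sub hca (dvd_mul_left (π ^ w t) (g t (partialSum u w g i t) c))
            convert h3 using 1
            ring
          rcases le_total j (w t) with h | h
          · exact (pow_dvd_pow π h).trans h2
          · refine dvd_sub_of_rigidAt h (fun r h4 h5 => (hA r (h5.trans_le hj)).2 ?_) ha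
              (hmem _ _ ht) h2
            rintro ⟨s, hs, h6, h7⟩
            rcases lt_trichotomy s t with h8 | rfl | h8
            · have := (hwu s t h8 ht).trans (huw t ht)
              omega
            · omega
            · have := hu s h8 hs
              omega
    obtain ⟨i, hi, hia⟩ := key n le_rfl
    refine ⟨i, hi, ?_⟩
    have h1 := hia k le_rfl fun s h1 h2 => by omega
    rw [hπ, ZMod.natCast_pow_eq_zero, zero_dvd_iff, sub_eq_zero] at h1
    rw [sum_coeffOfStep, h1]
  · rintro ⟨i, -, rfl⟩
    rw [sum_coeffOfStep]
    exact hmem i n le_rfl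

theorem exists_eq_digitForm_iff {p k n : ℕ} (hp : p.Prime) {u w : ℕ → ℕ}
    (huw : ∀ t < n, u t ≤ w t) (hwu : ∀ s t, s < t → t < n → w s ≤ u t) (hwk : ∀ t < n, w t ≤ k)
    (A : Set (ZMod (p ^ k))) :
    (∃ γ : CoeffFamily p k, (∀ t < n, γ t (fun _ => 0) = 0) ∧ A = digitForm p k n u w γ) ↔
      0 ∈ A ∧ IsDigitTree (p : ZMod (p ^ k)) k (freeLevels n u w) A := by
  constructor
  · rintro ⟨γ, hγ, rfl⟩
    exact ⟨zero_mem_digitForm hp hγ, isDigitTree_digitForm hp huw hwu hwk γ⟩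
  · rintro ⟨h0, hA⟩
    exact exists_eq_digitForm hp huw hwu hwk h0 hA

/-! ### Block data -/

theorem IsBlockData.le_of_le {k n : ℕ} {m l : ℕ → ℕ} (h : IsBlockData k n m l) {s t : ℕ}
    (hst : s ≤ t) (ht : t ≤ n) : m s ≤ m t := by
  induction t, hst using Nat.le_induction with
  | base => rfl
  | succ t _ ih => exact (ih (by omega)).trans (h.2.2.1 t ht).le

theorem IsBlockData.add_le {k n : ℕ} {m l : ℕ → ℕ} (h : IsBlockData k n m l) {t : ℕ}
    (ht : t < n) : m t + l t ≤ m (t + 1) := by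
  have h1 := (h.2.2.2 t ht).2
  have h2 := h.2.2.1 t ht
  omega

theorem IsBlockData.le {k n : ℕ} {m l : ℕ → ℕ} (h : IsBlockData k n m l) {t : ℕ}
    (ht : t ≤ n) : m t ≤ k :=
  (h.le_of_le ht le_rfl).trans h.2.1.le

theorem hasConnectionForm_iff {p k n : ℕ} (hp : p.Prime) {m l : ℕ → ℕ}
    (h : IsBlockData k n m l) (A : Set (ZMod (p ^ k))) :
    HasConnectionForm p k n m l A ↔
      0 ∈ A ∧ IsDigitTree (p : ZMod (p ^ k)) k (freeLevels n m fun t => m t + l t) A := by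
  rw [← exists_eq_digitForm_iff hp (fun t _ => Nat.le_add_right _ _)
    (fun s t hst ht => (h.add_le (hst.trans ht)).trans (h.le_of_le hst ht.le))
    (fun t ht => (h.add_le ht).trans (h.le ht))]
  simp only [HasConnectionForm, connectionForm, digitForm, Nat.add_sub_cancel_left]

/-- The intervals `[m_t, m_t + l_t)` and `[m_t + l_t, m_{t+1})` partition `{0, …, k - 1}`. -/
theorem IsBlockData.mem_freeLevels_iff {k n : ℕ} {m l : ℕ → ℕ} (h : IsBlockData k n m l)
    {j : ℕ} (hj : j < k) :
    j ∈ freeLevels n (fun t => m t + l t) (fun t => m (t + 1)) ↔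
      j ∈ (freeLevels n m fun t => m t + l t)ᶜ := by
  constructor
  · rintro ⟨t, ht, h1, h2⟩ ⟨s, hs, h3, h4⟩
    dsimp only at h1 h2 h4
    rcases lt_trichotomy s t with h5 | rfl | h5
    · have := h.add_le hs
      have := h.le_of_le (show s + 1 ≤ t from h5) ht.le
      omega
    · omega
    · have := h.le_of_le (show t + 1 ≤ s from h5) hs.le
      omega
  · intro hJ
    have key : ∀ t ≤ n, j < m t → ∃ s < t, m s ≤ j ∧ j < m (s + 1) := by
      intro t
      induction t with
      | zero => simp [h.1]
      | succ t ih =>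
        intro ht hjt
        rcases lt_or_ge j (m t) with h1 | h1
        · obtain ⟨s, hs, h2⟩ := ih (by omega) h1
          exact ⟨s, by omega, h2⟩
        · exact ⟨t, by omega, h1, hjt⟩
    obtain ⟨s, hs, h1, h2⟩ := key n le_rfl (by rwa [h.2.1])
    refine ⟨s, hs, ?_, h2⟩
    by_contra h3
    exact hJ ⟨s, hs, h1, not_le.1 h3⟩

theorem hasCodeForm_iff {p k n : ℕ} (hp : p.Prime) {m l : ℕ → ℕ}
    (h : IsBlockData k n m l) (C : Set (ZMod (p ^ k))) :
    HasCodeForm p k n m l C ↔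
      0 ∈ C ∧ IsDigitTree (p : ZMod (p ^ k)) k (freeLevels n m fun t => m t + l t)ᶜ C := by
  have h1 : IsDigitTree (p : ZMod (p ^ k)) k (freeLevels n m fun t => m t + l t)ᶜ C ↔
      IsDigitTree (p : ZMod (p ^ k)) k
        (freeLevels n (fun t => m t + l t) (fun t => m (t + 1))) C :=
    ⟨fun hC => hC.congr fun j hj => (h.mem_freeLevels_iff hj).symm,
      fun hC => hC.congr fun j hj => h.mem_freeLevels_iff hj⟩
  rw [h1, ← exists_eq_digitForm_iff hp (fun t ht => h.add_le ht)
    (fun s t hst ht => (h.le_of_le hst ht.le).trans (Nat.le_add_right _ _))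
    (fun t ht => h.le ht)]
  simp only [HasCodeForm, codeForm, digitForm, Nat.sub_sub]

open Classical in
/-- Any set of levels containing `0` comes from block data: every element of the set is made a
block of its own, so `m` enumerates the set and `l` is constantly `1`. -/
theorem exists_isBlockData (k : ℕ) {J : Set ℕ} (h0 : 0 ∈ J) :
    ∃ (n : ℕ) (m l : ℕ → ℕ), IsBlockData k n m l ∧
      ∀ j < k, (j ∈ J ↔ j ∈ freeLevels n m fun t => m t + l t) := by
  -- adding all levels from `k` on makes the enumeration infinite and lets it pass through `k`
  set q : ℕ → Prop := fun j => j ∈ J ∨ k ≤ j with hq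
  have hinf : (Set.ofPred q).Infinite :=
    (Set.Ici_infinite k).mono fun j hj => Or.inr hj
  have hmono : StrictMono (Nat.nth q) := Nat.nth_strictMono hinf
  have hnk : Nat.nth q (Nat.count q k) = k := Nat.nth_count (p := q) (Or.inr le_rfl)
  refine ⟨Nat.count q k, Nat.nth q, fun _ => 1, ⟨?_, hnk, fun t _ => hmono t.lt_succ_self,
    fun t _ => ⟨le_rfl, ?_⟩⟩, fun j hj => ⟨fun hJ => ?_, ?_⟩⟩
  · simpa using Nat.nth_count (p := q) (n := 0) (Or.inl h0)
  · exact Nat.le_sub_of_add_le' (hmono t.lt_succ_self)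
  · have h1 : Nat.nth q (Nat.count q j) = j := Nat.nth_count (p := q) (Or.inl hJ)
    exact ⟨Nat.count q j, Nat.count_strict_mono (p := q) (Or.inl hJ) hj, h1.le, by simp [h1]⟩
  · rintro ⟨t, -, h1, h2⟩
    dsimp only at h2
    have h3 : j = Nat.nth q t := by omega
    have h4 : q j := h3 ▸ Nat.nth_mem_of_infinite hinf t
    exact h4.resolve_right (not_le.2 hj)

/-! ### Perfect codes -/

/-- A generating set is not contained in the subgroup of multiples of `p`, so the level `0` is not
rigid. -/
theorem zero_mem_of_closure_eq_top {p k : ℕ} (hp : p.Prime) (hk : 0 < k) {S : Set (ZMod (p ^ k))}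
    (hgen : AddSubgroup.closure S = ⊤) {J : Set ℕ}
    (h : IsDigitTree (p : ZMod (p ^ k)) k J (insert 0 S)) : 0 ∈ J := by
  by_contra hJ
  have hr := (h 0 hk).2 hJ
  have hle : AddSubgroup.closure S ≤ (Ideal.span {(p : ZMod (p ^ k))}).toAddSubgroup := by
    rw [AddSubgroup.closure_le]
    intro s hs
    have := hr s (Set.mem_insert_of_mem _ hs) 0 (Set.mem_insert _ _) (by simp)
    exact Ideal.mem_span_singleton.2 (by simpa using this)
  rw [hgen] at hle
  have h1 : (p : ZMod (p ^ k)) ∣ 1 := Ideal.mem_span_singleton.1 (hle (AddSubgroup.mem_top 1))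
  exact ZMod.not_natCast_pow_succ_dvd_pow hp hk (by simpa using h1)

/-- Tilings by two sets containing `0` are the pairs of digit trees with complementary sets of
free levels. -/
theorem tiles_iff_exists_isDigitTree {p k : ℕ} (hp : p.Prime) {A C : Set (ZMod (p ^ k))}
    (hA : 0 ∈ A) (hC : 0 ∈ C) :
    Tiles A C ↔ ∃ J : Set ℕ, IsDigitTree (p : ZMod (p ^ k)) k J A ∧
      IsDigitTree (p : ZMod (p ^ k)) k Jᶜ C := by
  have hπ := ZMod.natCast_pow_eq_zero p k
  constructor
  · intro h
    exact h.exists_isDigitTree hπ (fun j hj => h.freeAt_or_freeAt hp hj) ⟨0, hA⟩ ⟨0, hC⟩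
  · rintro ⟨J, h1, h2⟩
    exact h1.tiles hπ h2 ⟨0, hA⟩ ⟨0, hC⟩

theorem mainTheorem5 (p k : ℕ) (hp : p.Prime) (hk : 0 < k)
    (S : Set (ZMod (p ^ k))) (hS : S ⊂ {0}ᶜ) (hgen : AddSubgroup.closure S = ⊤)
    (C : Set (ZMod (p ^ k))) (hC : 0 ∈ C) :
    (IsPerfectCode (cayleyDigraph S) C ↔
      ∃ (n : ℕ) (m l : ℕ → ℕ), IsBlockData k n m l ∧
        HasConnectionForm p k n m l (insert 0 S) ∧ HasCodeForm p k n m l C) ∧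
    (∀ (n : ℕ) (m l : ℕ → ℕ), IsBlockData k n m l →
      HasConnectionForm p k n m l (insert 0 S) →
      (IsPerfectCode (cayleyDigraph S) C ↔ HasCodeForm p k n m l C)) := by
  have h0 : (0 : ZMod (p ^ k)) ∈ insert 0 S := Set.mem_insert _ _
  rw [isPerfectCode_cayleyDigraph_iff, tiles_iff_exists_isDigitTree hp h0 hC]
  refine ⟨⟨?_, ?_⟩, ?_⟩
  · rintro ⟨J, hA, hC'⟩
    obtain ⟨n, m, l, hb, hJ⟩ := exists_isBlockData k (zero_mem_of_closure_eq_top hp hk hgen hA)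
    exact ⟨n, m, l, hb, (hasConnectionForm_iff hp hb _).2 ⟨h0, hA.congr hJ⟩,
      (hasCodeForm_iff hp hb _).2 ⟨hC, hC'.congr fun j hj => not_congr (hJ j hj)⟩⟩
  · rintro ⟨n, m, l, hb, hA, hC'⟩
    exact ⟨_, ((hasConnectionForm_iff hp hb _).1 hA).2, ((hasCodeForm_iff hp hb _).1 hC').2⟩
  · intro n m l hb hA
    have hA' := ((hasConnectionForm_iff hp hb _).1 hA).2
    rw [hasCodeForm_iff hp hb]
    constructor
    · rintro ⟨J, hJA, hJC⟩
      -- the free levels of `insert 0 S` are those of the given blocks, by uniqueness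
      exact ⟨hC, hJC.congr fun j hj => not_congr (hJA.mem_iff_mem ⟨0, h0⟩
        (fun i hi => ZMod.not_natCast_pow_succ_dvd_pow hp hi) hA' hj)⟩
    · exact fun h => ⟨_, hA', h.2⟩
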